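/- Let $d \ge 0$ be an integer, and call a subset of $\mathbb{R}^d$ proper $d$-dimensional if it is not contained in any affine hyperplane, that is, in any set $\{x \in \mathbb{R}^d : f(x) = c\}$ with $f$ a nonzero linear functional on $\mathbb{R}^d$ and $c \in \mathbb{R}$. Let $A, B \subset \mathbb{R}^d$ be finite sets with $|A| = m$. Assume that $B$ is proper $d$-dimensional and that $A \subset \operatorname{conv} B$, where $\operatorname{conv} B$ is the convex hull of $B$. Then the sumset $A + B = \{a + b : a \in A,\ b \in B\}$ satisfies $$ |A+B| \ge m(d+1) - \frac{d(d+1)}{2}. $$ -/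

import Mathlib

open scoped Pointwise

/-- An affine hyperplane of `ℝ^d`: a level set of a nonzero linear functional. -/
def IsAffineHyperplane {d : ℕ} (H : Set (EuclideanSpace ℝ (Fin d))) : Prop :=
  ∃ (f : EuclideanSpace ℝ (Fin d) →ₗ[ℝ] ℝ) (c : ℝ), f ≠ 0 ∧ H = {x | f x = c}

/-- A subset of `ℝ^d` is proper `d`-dimensional if no affine hyperplane contains it. -/
def IsProperDimensional {d : ℕ} (B : Set (EuclideanSpace ℝ (Fin d))) : Prop :=
  ∀ H : Set (EuclideanSpace ℝ (Fin d)), IsAffineHyperplane H → ¬ B ⊆ H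

open Module Finset Topology

/-! Placed at height one, `B` spans a space of dimension `d + 1`; generic heights triangulate its
cone into cells, each a basis drawn from `B`. Giving every `a ∈ A` a cell `T a` whose cone contains
it yields `m (d + 1)` pairs `(a, b)` with `b ∈ T a`.

Conic coefficients supported on a cell do not depend on the cell (`IsConicRep.unique`), so two pairs
with equal sums must be swaps `(u, v)`, `(v, u)` (`swap_of_add_eq`). To limit the swaps, `T a` is
chosen to contain also the start of the ray from `a` in the direction of an interior point of one
fixed cell `T₀` (`exists_isCell_segment`). Swapped vertices then lie in `T₀`
(`mem_of_isConicRep_toward`), so at most `(d + 1).choose 2` sums are lost. -/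

theorem card_filter_lt_le_choose {α : Type*} [LinearOrder α] (S : Finset α) :
    #((S ×ˢ S).filter fun p => p.1 < p.2) ≤ (#S).choose 2 := by
  rw [← card_powersetCard]
  refine card_le_card_of_injOn (fun p => {p.1, p.2}) (fun p hp => ?_) ?_
  · simp only [coe_filter, mem_product, Set.mem_ofPred_eq] at hp
    simp only [mem_coe, mem_powersetCard, card_pair hp.2.ne, and_true]
    simp [insert_subset_iff, hp.1]
  · rintro ⟨a, b⟩ hp ⟨a', b'⟩ hq heq
    simp only [coe_filter, mem_product, Set.mem_ofPred_eq] at hp hq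
    have heq : ({a, b} : Finset α) = {a', b'} := heq
    have ha : a ∈ ({a', b'} : Finset α) := heq ▸ mem_insert_self a {b}
    have hb : b ∈ ({a', b'} : Finset α) := heq ▸ mem_insert_of_mem (mem_singleton_self b)
    simp only [mem_insert, mem_singleton] at ha hb
    rcases ha with rfl | rfl <;> rcases hb with rfl | rfl
    · exact absurd hp.2 (lt_irrefl _)
    · rfl
    · exact absurd hq.2 hp.2.not_gt
    · exact absurd hp.2 (lt_irrefl _)

/-! ### Generic heights and cells -/

/-- Heights on `B` such that the points where a linear functional attains them are always linearly
independent. -/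
theorem exists_generic_height {V : Type*} [AddCommGroup V] [Module ℝ V] (B : Finset V) :
    ∃ h : V → ℝ, (∀ b, 0 ≤ h b) ∧
      ∀ f : Dual ℝ V, LinearIndepOn ℝ id {b | b ∈ B ∧ f b = h b} := by
  classical
  induction B using Finset.induction_on with
  | empty => exact ⟨0, fun _ => le_rfl, fun f => by simp⟩
  | insert b s hb ih =>
    obtain ⟨h, h0, hh⟩ := ih
    -- Each `T` whose span contains `b` forces at most one value at `b`; the new height avoids these
    -- finitely many values.
    have hfin : (⋃ T ∈ s.powerset, {r : ℝ | ∃ f : Dual ℝ V, (∀ t ∈ T, f t = h t) ∧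
        b ∈ Submodule.span ℝ (T : Set V) ∧ f b = r}).Finite := by
      refine Set.Finite.biUnion s.powerset.finite_toSet fun T _ => Set.Subsingleton.finite ?_
      rintro _ ⟨f, hf, hbT, rfl⟩ _ ⟨g, hg, -, rfl⟩
      exact LinearMap.eqOn_span (f := f) (g := g) (fun t ht => (hf t ht).trans (hg t ht).symm) hbT
    obtain ⟨r, hr0, hr⟩ := (Set.Ici_infinite (0 : ℝ)).exists_notMem_finite hfin
    refine ⟨Function.update h b r, fun x => ?_, fun f => ?_⟩
    · by_cases hx : x = b
      · subst hx; simpa using hr0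
      · simpa [hx] using h0 x
    · by_cases hfb : f b = r
      · have hset : {x | x ∈ insert b s ∧ f x = Function.update h b r x} =
            insert b {x | x ∈ s ∧ f x = h x} := by
          ext x
          by_cases hx : x = b
          · subst hx; simp [hfb]
          · simp [hx]
        rw [hset]
        refine (hh f).id_insert fun hmem => hr ?_
        refine Set.mem_biUnion (x := s.filter fun x => f x = h x)
          (mem_powerset.2 (filter_subset _ _)) ?_
        exact ⟨f, by simp, by simpa using hmem, hfb⟩
      · convert hh f using 1
        ext x
        by_cases hx : x = b
        · subst hx; simp [hfb, hb]
        · simp [hx]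

/-- `T` is a maximal cell of the regular triangulation of `B` induced by the heights `h`. -/
structure IsCell {V : Type*} [AddCommGroup V] [Module ℝ V] (B : Finset V) (h : V → ℝ)
    (T : Finset V) : Prop where
  exists_support : ∃ f : Dual ℝ V, (∀ b ∈ B, f b ≤ h b) ∧ ∀ b, b ∈ T ↔ b ∈ B ∧ f b = h b
  linearIndepOn : LinearIndepOn ℝ id (T : Set V)
  span_eq_top : Submodule.span ℝ (T : Set V) = ⊤

/-- `c` gives nonnegative coefficients of `x` in the members of `T`. -/
structure IsConicRep {V : Type*} [AddCommGroup V] [Module ℝ V] (T : Finset V) (c : V → ℝ)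
    (x : V) : Prop where
  nonneg : ∀ t, 0 ≤ c t
  eq_zero : ∀ t, t ∉ T → c t = 0
  sum_eq : ∑ t ∈ T, c t • t = x

/-! ### Conic representations and their uniqueness -/

section
variable {V : Type*} [AddCommGroup V] [Module ℝ V] {B : Finset V} {h : V → ℝ} {T T' : Finset V}
  {c c' : V → ℝ} {x y : V}

theorem IsCell.subset (hT : IsCell B h T) : T ⊆ B := by
  obtain ⟨f, -, hf⟩ := hT.exists_support
  exact fun b hb => ((hf b).1 hb).1

theorem IsConicRep.mono (hc : IsConicRep T c x) (hTT' : T ⊆ T') : IsConicRep T' c x :=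
  ⟨hc.nonneg, fun t ht => hc.eq_zero t fun h => ht (hTT' h), by
    rw [← hc.sum_eq]
    exact (sum_subset hTT' fun t _ ht => by rw [hc.eq_zero t ht, zero_smul]).symm⟩

theorem IsConicRep.add (hc : IsConicRep T c x) (hc' : IsConicRep T c' y) :
    IsConicRep T (c + c') (x + y) :=
  ⟨fun t => add_nonneg (hc.nonneg t) (hc'.nonneg t),
    fun t ht => by simp [hc.eq_zero t ht, hc'.eq_zero t ht],
    by simp [add_smul, sum_add_distrib, hc.sum_eq, hc'.sum_eq]⟩

theorem IsConicRep.smul (hc : IsConicRep T c x) {r : ℝ} (hr : 0 ≤ r) :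
    IsConicRep T (r • c) (r • x) :=
  ⟨fun t => mul_nonneg hr (hc.nonneg t), fun t ht => by simp [hc.eq_zero t ht],
    by simp [mul_smul, ← smul_sum, hc.sum_eq]⟩

theorem isConicRep_single [DecidableEq V] {b : V} (hb : b ∈ T) :
    IsConicRep T (Pi.single b (1 : ℝ)) b :=
  ⟨fun t => by by_cases h : t = b <;> simp [h],
    fun t ht => by simp [show t ≠ b from fun h => ht (h ▸ hb)],
    by simp [Pi.single_apply, hb]⟩

theorem IsConicRep.map_eq (hc : IsConicRep T c x) (f : Dual ℝ V) :
    f x = ∑ t ∈ T, c t * f t := by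
  rw [← hc.sum_eq]; simp

/-- A linear functional below `h` that attains the height of `x` agrees with `h` on the support. -/
theorem IsConicRep.tight (hc : IsConicRep B c x) {f : Dual ℝ V} (hf : ∀ b ∈ B, f b ≤ h b)
    (hx : ∑ b ∈ B, c b * h b ≤ f x) {b : V} (hb : c b ≠ 0) : b ∈ B ∧ f b = h b := by
  have hbB : b ∈ B := by by_contra hbB; exact hb (hc.eq_zero b hbB)
  refine ⟨hbB, ?_⟩
  rw [hc.map_eq] at hx
  have hle : ∀ t ∈ B, c t * f t ≤ c t * h t := fun t ht =>
    mul_le_mul_of_nonneg_left (hf t ht) (hc.nonneg t)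
  have := (sum_eq_sum_iff_of_le hle).1 (le_antisymm (sum_le_sum hle) hx) b hbB
  exact mul_left_cancel₀ hb this

theorem IsCell.height_eq (hT : IsCell B h T) (hc : IsConicRep T c x) {f : Dual ℝ V}
    (hf : ∀ b, b ∈ T ↔ b ∈ B ∧ f b = h b) : f x = ∑ b ∈ B, c b * h b := by
  rw [(hc.mono hT.subset).map_eq]
  refine sum_congr rfl fun b _ => ?_
  by_cases hb : b ∈ T
  · rw [((hf b).1 hb).2]
  · rw [hc.eq_zero b hb, zero_mul, zero_mul]

theorem IsConicRep.height_le (hc : IsConicRep B c x) {f : Dual ℝ V} (hf : ∀ b ∈ B, f b ≤ h b) :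
    f x ≤ ∑ b ∈ B, c b * h b := by
  rw [hc.map_eq]
  exact sum_le_sum fun t ht => mul_le_mul_of_nonneg_left (hf t ht) (hc.nonneg t)

/-- The supports satisfy `f' x ≤ f x`, and `f' x` is the height of the `T'`-combination. Hence `f`
is tight on the support of `c'`, which therefore lies in the independent set `T`. -/
theorem IsConicRep.unique (hT : IsCell B h T) (hT' : IsCell B h T') (hc : IsConicRep T c x)
    (hc' : IsConicRep T' c' x) : c = c' := by
  obtain ⟨f, hfB, hf⟩ := hT.exists_support
  obtain ⟨f', hfB', hf'⟩ := hT'.exists_support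
  have hc'T : IsConicRep T c' x := by
    have hzero : ∀ t, t ∉ T → c' t = 0 := fun t ht => by
      by_contra hne
      refine ht ((hf t).2 ((hc'.mono hT'.subset).tight hfB ?_ hne))
      rw [← hT'.height_eq hc' hf', hT.height_eq hc hf]
      exact (hc.mono hT.subset).height_le hfB'
    refine ⟨hc'.nonneg, hzero, ?_⟩
    rw [← (hc'.mono hT'.subset).sum_eq]
    exact sum_subset hT.subset fun t _ ht => by rw [hzero t ht, zero_smul]
  have hli := linearIndepOn_finset_iff.1 hT.linearIndepOn (fun t => c t - c' t)
    (by simp [sub_smul, hc.sum_eq, hc'T.sum_eq])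
  funext t
  by_cases ht : t ∈ T
  · exact sub_eq_zero.1 (hli t ht)
  · rw [hc.eq_zero t ht, hc'T.eq_zero t ht]

theorem IsCell.card_eq (hT : IsCell B h T) : #T = finrank ℝ V := by
  have := finrank_span_set_eq_card hT.linearIndepOn
  rw [hT.span_eq_top, finrank_top] at this
  simpa using this.symm

/-- The coordinate functionals of a finite basis, extended by zero. -/
theorem exists_coord [DecidableEq V] (hli : LinearIndepOn ℝ id (T : Set V))
    (hs : Submodule.span ℝ (T : Set V) = ⊤) : ∃ φ : V → Dual ℝ V, (∀ t, t ∉ T → φ t = 0) ∧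
      (∀ x, ∑ t ∈ T, φ t x • t = x) ∧ ∀ t ∈ T, ∀ s ∈ T, φ t s = if s = t then 1 else 0 := by
  let bas : Basis T ℝ V := Basis.mk (v := fun t : T => (t : V)) hli (by
    rw [Subtype.range_coe_subtype]; exact hs.ge)
  have hbas : ∀ t : T, bas t = t := fun t => Basis.mk_apply _ _ t
  refine ⟨fun t => if ht : t ∈ T then bas.coord ⟨t, ht⟩ else 0, fun t ht => by simp [ht],
    fun x => ?_, fun t ht s hs' => ?_⟩
  · rw [← sum_coe_sort]
    conv_rhs => rw [← bas.sum_repr x]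
    exact sum_congr rfl fun t _ => by simp [hbas]
  · have : bas.repr s = Finsupp.single ⟨s, hs'⟩ 1 := by rw [← bas.repr_self, hbas]
    simp [ht, this, Finsupp.single_apply]

/-! ### Covering by cells, via linear programming -/

/-- Moving a functional below `h` along a direction vanishing on its tight set, until a new
constraint becomes tight. -/
theorem exists_larger_tight {f g : Dual ℝ V} (hf : ∀ b ∈ B, f b ≤ h b)
    (hg : ∀ b ∈ B, f b = h b → g b = 0) (hpos : ∃ b ∈ B, 0 < g b) (hx : 0 ≤ g x) :
    ∃ f' : Dual ℝ V, (∀ b ∈ B, f' b ≤ h b) ∧ f x ≤ f' x ∧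
      B.filter (fun b => f b = h b) ⊂ B.filter (fun b => f' b = h b) := by
  obtain ⟨b₀, hb₀, hmin⟩ := exists_min_image (B.filter fun b => 0 < g b)
    (fun b => (h b - f b) / g b) (by simpa [Finset.Nonempty] using hpos)
  rw [mem_filter] at hb₀
  set r := (h b₀ - f b₀) / g b₀ with hr
  have hr0 : 0 ≤ r := div_nonneg (sub_nonneg.2 (hf b₀ hb₀.1)) hb₀.2.le
  have htight : (f + r • g) b₀ = h b₀ := by
    have := hb₀.2.ne'
    simp [hr, this]
  refine ⟨f + r • g, fun b hb => ?_, ?_, ?_⟩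
  · change f b + r * g b ≤ h b
    rcases le_or_gt (g b) 0 with hgb | hgb
    · nlinarith [hf b hb]
    · have := hmin b (mem_filter.2 ⟨hb, hgb⟩)
      rw [le_div_iff₀ hgb] at this
      linarith
  · change f x ≤ f x + r * g x
    nlinarith
  · refine (ssubset_iff_of_subset fun b hb => ?_).2 ⟨b₀, mem_filter.2 ⟨hb₀.1, htight⟩, fun hb => ?_⟩
    · rw [mem_filter] at hb ⊢
      exact ⟨hb.1, by simp [hg b hb.1 hb.2, hb.2]⟩
    · rw [mem_filter] at hb
      exact hb₀.2.ne' (hg b₀ hb.1 hb.2)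

/-- A linear program bounded at `x` can be improved to a vertex: while the tight set does not span,
moving along a functional that kills it enlarges it. -/
theorem exists_vertex_ge (hB : Submodule.span ℝ (B : Set V) = ⊤) (hc : IsConicRep B c x)
    (f : Dual ℝ V) (hf : ∀ b ∈ B, f b ≤ h b) :
    ∃ f' : Dual ℝ V, (∀ b ∈ B, f' b ≤ h b) ∧ f x ≤ f' x ∧
      Submodule.span ℝ ((B.filter fun b => f' b = h b : Finset V) : Set V) = ⊤ := by
  induction hk : #B - #(B.filter fun b => f b = h b) using Nat.strong_induction_on
    generalizing f with
  | _ k ih =>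
  by_cases hs : Submodule.span ℝ ((B.filter fun b => f b = h b : Finset V) : Set V) = ⊤
  · exact ⟨f, hf, le_rfl, hs⟩
  obtain ⟨g, hg0, hg⟩ := Submodule.exists_le_ker_of_lt_top _ (lt_top_iff_ne_top.2 hs)
  have hgt : ∀ b ∈ B, f b = h b → g b = 0 := fun b hb hfb =>
    hg (Submodule.subset_span (by simp [hb, hfb]))
  -- The sign of `g` is chosen so that `x` does not lose value and some constraint stops the motion.
  obtain ⟨g, hgt, hpos, hgx⟩ : ∃ g : Dual ℝ V, (∀ b ∈ B, f b = h b → g b = 0) ∧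
      (∃ b ∈ B, 0 < g b) ∧ 0 ≤ g x := by
    have key : ∀ g : Dual ℝ V, 0 < g x → ∃ b ∈ B, 0 < g b := fun g hgx => by
      by_contra! hle
      rw [hc.map_eq] at hgx
      exact hgx.not_ge (sum_nonpos fun b hb => mul_nonpos_of_nonneg_of_nonpos (hc.nonneg b) (hle b hb))
    obtain ⟨b, hb, hgb⟩ : ∃ b ∈ B, g b ≠ 0 := by
      by_contra! hall
      exact hg0 (LinearMap.ext_on hB fun b hb => by simpa using hall b hb)
    have hneg : ∀ b ∈ B, f b = h b → (-g) b = 0 := fun b hb hfb => by simp [hgt b hb hfb]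
    rcases lt_trichotomy (g x) 0 with hx | hx | hx
    · have hx' : 0 < (-g) x := by simpa using hx
      exact ⟨-g, hneg, key _ hx', hx'.le⟩
    · rcases lt_or_gt_of_ne hgb with hlt | hgt'
      · exact ⟨-g, hneg, ⟨b, hb, by simpa using hlt⟩, by simp [hx]⟩
      · exact ⟨g, hgt, ⟨b, hb, hgt'⟩, hx.ge⟩
    · exact ⟨g, hgt, key g hx, hx.le⟩
  obtain ⟨f₁, hf₁, hle, hss⟩ := exists_larger_tight hf hgt hpos hgx
  have h1 := card_lt_card hss
  have h2 := card_le_card (filter_subset (fun b => f₁ b = h b) B)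
  obtain ⟨f₂, hf₂, hle₂, hs₂⟩ := ih _ (by omega) f₁ hf₁ rfl
  exact ⟨f₂, hf₂, hle.trans hle₂, hs₂⟩

/-- The cones over the cells cover the cone over `B`. -/
theorem exists_isCell_isConicRep (hB : Submodule.span ℝ (B : Set V) = ⊤) (h0 : ∀ b, 0 ≤ h b)
    (hgen : ∀ f : Dual ℝ V, LinearIndepOn ℝ id {b | b ∈ B ∧ f b = h b})
    (hc : IsConicRep B c x) : ∃ T, IsCell B h T ∧ ∃ c', IsConicRep T c' x := by
  classical
  let vertexSet : Set (Dual ℝ V) := {f | (∀ b ∈ B, f b ≤ h b) ∧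
    Submodule.span ℝ ((B.filter fun b => f b = h b : Finset V) : Set V) = ⊤}
  -- A vertex is determined by its spanning tight set, so a best vertex exists and is optimal among
  -- all functionals below `h`.
  have hfin : vertexSet.Finite := by
    refine Set.Finite.of_injOn (f := fun f : Dual ℝ V => B.filter fun b => f b = h b)
      (t := (B.powerset : Set (Finset V))) 
      (fun f _ => mem_powerset.2 (filter_subset _ _)) ?_ B.powerset.finite_toSet
    intro f hf g hg hfg
    refine LinearMap.ext_on hf.2 fun b hb => ?_
    have hb' : b ∈ B.filter fun b => g b = h b := by
      have : (B.filter fun b => f b = h b) = B.filter fun b => g b = h b := hfg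
      rw [← this]; exact hb
    exact (mem_filter.1 hb).2.trans (mem_filter.1 hb').2.symm
  obtain ⟨f₀, hf₀, -, hs₀⟩ := exists_vertex_ge hB hc (0 : Dual ℝ V) (h := h)
    (fun b _ => by simpa using h0 b)
  obtain ⟨f, ⟨hf, hs⟩, hmax⟩ := hfin.exists_maximalFor (fun f => f x) _ ⟨f₀, hf₀, hs₀⟩
  have hopt : ∀ g : Dual ℝ V, (∀ b ∈ B, g b ≤ h b) → g x ≤ f x := fun g hg => by
    obtain ⟨g', hg', hle, hsg⟩ := exists_vertex_ge hB hc g hg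
    rcases le_total (g' x) (f x) with h1 | h1
    · exact hle.trans h1
    · exact hle.trans (hmax ⟨hg', hsg⟩ h1)
  set T := B.filter fun b => f b = h b with hT
  have hmemT : ∀ b, b ∈ T ↔ b ∈ B ∧ f b = h b := fun b => by rw [hT, mem_filter]
  have hli : LinearIndepOn ℝ id (T : Set V) := by
    convert hgen f using 1
    ext b; simp [hT]
  refine ⟨T, ⟨⟨f, hf, hmemT⟩, hli, hs⟩, ?_⟩
  obtain ⟨φ, hφ0, hφsum, hφT⟩ := exists_coord hli hs
  refine ⟨fun t => φ t x, fun t => ?_, fun t ht => by simp [hφ0 t ht], hφsum x⟩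
  by_contra! hlt
  have ht : t ∈ T := by
    by_contra ht
    simp [hφ0 t ht] at hlt
  -- decreasing the value at `t` alone keeps the functional below `h` and raises it at `x`
  have hsmall : ∀ b ∈ B, ∃ ε > 0, ∀ δ : ℝ, 0 < δ → δ ≤ ε → f b - δ * φ t b ≤ h b := by
    intro b hb
    by_cases hbT : b ∈ T
    · refine ⟨1, one_pos, fun δ hδ _ => ?_⟩
      have hr : 0 ≤ φ t b := by
        rw [hφT t ht b hbT]
        split_ifs <;> norm_num
      nlinarith [hf b hb]
    · have hlt' : f b < h b := lt_of_le_of_ne (hf b hb) fun he => hbT ((hmemT b).2 ⟨hb, he⟩)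
      refine ⟨(h b - f b) / (|φ t b| + 1), div_pos (by linarith) (by positivity),
        fun δ hδ hδε => ?_⟩
      rw [le_div_iff₀ (by positivity)] at hδε
      nlinarith [neg_abs_le (φ t b)]
  choose! ε hε hεb using hsmall
  obtain ⟨δ, hδ, hδε⟩ : ∃ δ > 0, ∀ b ∈ B, δ ≤ ε b := by
    rcases B.eq_empty_or_nonempty with hBe | hBn
    · exact ⟨1, one_pos, by simp [hBe]⟩
    · obtain ⟨b₁, hb₁, hm⟩ := exists_min_image B ε hBn
      exact ⟨ε b₁, hε b₁ hb₁, hm⟩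
  have := hopt (f - δ • φ t) fun b hb => by
    simpa using hεb b hb δ hδ (hδε b hb)
  simp only [LinearMap.sub_apply, LinearMap.smul_apply, smul_eq_mul] at this
  nlinarith

/-- Some cell contains `x` and the initial part of the ray from `x` in the direction `z`. -/
theorem exists_isCell_segment {z : V} {cz : V → ℝ} (hB : Submodule.span ℝ (B : Set V) = ⊤)
    (h0 : ∀ b, 0 ≤ h b) (hgen : ∀ f : Dual ℝ V, LinearIndepOn ℝ id {b | b ∈ B ∧ f b = h b})
    (hc : IsConicRep B c x) (hz : IsConicRep B cz z) :
    ∃ T, IsCell B h T ∧ ∃ ε > 0, ∀ δ : ℝ, 0 ≤ δ → δ ≤ ε → ∃ c', IsConicRep T c' (x + δ • z) := by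
  classical
  -- Finitely many cells cover the cone, so one of them recurs for arbitrarily small `δ`. Its
  -- coordinates are nonnegative at `x` by continuity, then on a whole segment by affinity in `δ`.
  obtain ⟨T, hT, hfreq⟩ : ∃ T, IsCell B h T ∧
      ∃ᶠ δ : ℝ in 𝓝[>] 0, ∃ c', IsConicRep T c' (x + δ • z) := by
    by_contra! hcon
    have hall : ∀ᶠ δ : ℝ in 𝓝[>] 0, ∀ T ∈ B.powerset, IsCell B h T →
        ¬ ∃ c', IsConicRep T c' (x + δ • z) := by
      rw [Filter.eventually_all_finset]
      intro T _
      by_cases hT : IsCell B h T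
      · filter_upwards [hcon T hT] with δ hδ _ ⟨c', hc'⟩ using hδ c' hc'
      · exact Filter.Eventually.of_forall fun δ hT' => absurd hT' hT
    obtain ⟨δ, hδ, hδ0⟩ := (hall.and self_mem_nhdsWithin).exists
    obtain ⟨T, hT, hrep⟩ :=
      exists_isCell_isConicRep hB h0 hgen (hc.add (hz.smul (le_of_lt hδ0)))
    exact hδ T (mem_powerset.2 hT.subset) hT hrep
  obtain ⟨φ, hφ0, hφsum, hφT⟩ := exists_coord hT.linearIndepOn hT.span_eq_top
  have hcoord : ∀ {y : V} {c' : V → ℝ}, IsConicRep T c' y → ∀ t, 0 ≤ φ t y := by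
    intro y c' hc' t
    by_cases ht : t ∈ T
    · rw [hc'.map_eq]
      refine sum_nonneg fun s hs => mul_nonneg (hc'.nonneg s) ?_
      rw [hφT t ht s hs]
      split_ifs <;> norm_num
    · simp [hφ0 t ht]
  have hx : ∀ t, 0 ≤ φ t x := by
    intro t
    by_contra! hlt
    have hcont : Filter.Tendsto (fun δ : ℝ => φ t x + δ * φ t z) (𝓝[>] 0) (𝓝 (φ t x)) := by
      have : Continuous fun δ : ℝ => φ t x + δ * φ t z := by fun_prop
      simpa using (this.tendsto 0).mono_left nhdsWithin_le_nhds
    obtain ⟨δ, ⟨c', hc'⟩, hneg⟩ := (hfreq.and_eventually (hcont.eventually_lt_const hlt)).exists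
    have := hcoord hc' t
    simp only [map_add, map_smul, smul_eq_mul] at this
    linarith
  obtain ⟨ε, ⟨c', hc'⟩, hε⟩ := (hfreq.and_eventually self_mem_nhdsWithin).exists
  have hε : 0 < ε := hε
  refine ⟨T, hT, ε, hε, fun δ hδ0 hδ => ⟨fun t => φ t (x + δ • z), fun t => ?_,
    fun t ht => by simp [hφ0 t ht], hφsum _⟩⟩
  have h1 := hcoord hc' t
  simp only [map_add, map_smul, smul_eq_mul] at h1 ⊢
  nlinarith [hx t, mul_nonneg (sub_nonneg.2 hδ) (hx t), mul_nonneg hδ0 h1]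

/-! ### Coincidences between sums -/

/-- If `a + b = a' + b'` with `b ≠ b'` in cells containing `a` and `a'`, all of weight one, then
the two sums differ by a swap. -/
theorem swap_of_add_eq {ℓ : Dual ℝ V} (hℓ : ∀ b ∈ B, ℓ b = 1) (hT : IsCell B h T)
    (hT' : IsCell B h T') {a a' b b' : V} (ha : ℓ a = 1) (hc : IsConicRep T c a)
    (hc' : IsConicRep T' c' a') (hb : b ∈ T) (hb' : b' ∈ T') (heq : a + b = a' + b')
    (hne : b ≠ b') : a = b' := by
  classical
  have hrep := (hc.add (isConicRep_single hb)).unique hT hT'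
    (heq ▸ hc'.add (isConicRep_single hb'))
  -- Comparing coefficients at `b'` gives it weight at least one, which is the total weight of `a`.
  have h1 : 1 ≤ c b' := by
    have := congrFun hrep b'
    simp only [Pi.add_apply, Pi.single_eq_same, Pi.single_eq_of_ne hne.symm] at this
    linarith [hc'.nonneg b']
  have hbT : b' ∈ T := by
    by_contra hn
    rw [hc.eq_zero b' hn] at h1
    linarith
  have hsum : ∑ t ∈ T, c t = 1 := by
    rw [← ha, hc.map_eq ℓ]
    exact sum_congr rfl fun t ht => by rw [hℓ t (hT.subset ht), mul_one]
  rw [← add_sum_erase _ _ hbT] at hsum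
  have hnn : ∀ t ∈ T.erase b', 0 ≤ c t := fun t _ => hc.nonneg t
  have hz := (sum_eq_zero_iff_of_nonneg hnn).1 (by linarith [sum_nonneg hnn])
  have hone : c b' = 1 := by linarith [sum_nonneg hnn]
  rw [← hc.sum_eq, ← add_sum_erase _ _ hbT, hone, one_smul,
    sum_eq_zero fun t ht => by rw [hz t ht, zero_smul], add_zero]

/-- If two distinct vertices `u`, `v` both look towards the barycentre of a cell `T₀` through
cells containing both of them, then they are vertices of `T₀`. -/
theorem mem_of_isConicRep_toward {T₀ : Finset V} {u v : V} {δ : ℝ} (hT₀ : IsCell B h T₀)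
    (hT : IsCell B h T) (hT' : IsCell B h T') (hδ : 0 < δ)
    (hc : IsConicRep T c (u + δ • ∑ t ∈ T₀, t)) (hc' : IsConicRep T' c' (v + δ • ∑ t ∈ T₀, t))
    (hv : v ∈ T) (hu : u ∈ T') (huv : u ≠ v) : u ∈ T₀ := by
  classical
  have hrep := (hc.add (isConicRep_single hv)).unique hT hT'
    ((show v + δ • ∑ t ∈ T₀, t + u = u + δ • ∑ t ∈ T₀, t + v by abel) ▸
      hc'.add (isConicRep_single hu))
  have h1 : 1 ≤ c u := by
    have := congrFun hrep u
    simp only [Pi.add_apply, Pi.single_eq_same, Pi.single_eq_of_ne huv] at this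
    linarith [hc'.nonneg u]
  have huT : u ∈ T := by
    by_contra hn
    rw [hc.eq_zero u hn] at h1
    linarith
  -- Removing `u` represents the interior point of `T₀` over `T`; by uniqueness every vertex of `T₀`
  -- has coefficient `δ > 0` there, so `T₀ = T`.
  have hz : IsConicRep T (c - Pi.single u 1) (δ • ∑ t ∈ T₀, t) := by
    refine ⟨fun t => ?_, fun t ht => ?_, ?_⟩
    · by_cases ht : t = u
      · subst ht; simpa using h1
      · simpa [ht] using hc.nonneg t
    · simp [hc.eq_zero t ht, show t ≠ u from fun h => ht (h ▸ huT)]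
    · simp [sub_smul, hc.sum_eq, (isConicRep_single huT).sum_eq]
  have hz₀ : IsConicRep T₀ (fun t => if t ∈ T₀ then δ else 0) (δ • ∑ t ∈ T₀, t) :=
    ⟨fun t => by split_ifs <;> positivity, fun t ht => by simp [ht], by
      rw [smul_sum]
      exact sum_congr rfl fun t ht => by simp [ht]⟩
  have heq := hz₀.unique hT₀ hT hz
  have hsub : T₀ ⊆ T := fun t ht => by
    by_contra hn
    have := congrFun heq t
    rw [hz.eq_zero t hn] at this
    simp [ht] at this
    exact hδ.ne' this
  rwa [eq_of_subset_of_card_le hsub (by rw [hT.card_eq, hT₀.card_eq])]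

/-! ### Counting -/

/-- The homogeneous form of the sumset bound. -/
theorem card_mul_finrank_le [DecidableEq V] {A : Finset V} {ℓ : Dual ℝ V}
    (hℓ : ∀ b ∈ B, ℓ b = 1) (hB : Submodule.span ℝ (B : Set V) = ⊤)
    (hA : ∀ a ∈ A, a ∈ convexHull ℝ (B : Set V)) :
    #A * finrank ℝ V ≤ #(A + B) + (finrank ℝ V).choose 2 := by
  obtain ⟨h, h0, hgen⟩ := exists_generic_height B
  -- The vector `0` serves only to produce some cell.
  obtain ⟨T₀, hT₀, -⟩ := exists_isCell_isConicRep (x := 0) (c := 0) hB h0 hgen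
    ⟨fun _ => le_rfl, fun _ _ => rfl, by simp⟩
  have hz : IsConicRep B (fun t => if t ∈ T₀ then (1 : ℝ) else 0) (∑ t ∈ T₀, t) := by
    refine IsConicRep.mono (T := T₀) ⟨fun t => ?_, fun t ht => by simp [ht], ?_⟩ hT₀.subset
    · split_ifs <;> norm_num
    · exact sum_congr rfl fun t ht => by simp [ht]
  have hArep : ∀ a ∈ A, ℓ a = 1 ∧ ∃ c, IsConicRep B c a := by
    intro a ha
    obtain ⟨w, hw0, hw1, hwa⟩ := mem_convexHull'.1 (hA a ha)
    have hrep : IsConicRep B (fun t => if t ∈ B then w t else 0) a :=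
      ⟨fun t => by
        split_ifs with ht
        exacts [hw0 t ht, le_rfl], fun t ht => by simp [ht], by
        rw [← hwa]
        exact sum_congr rfl fun t ht => by simp [ht]⟩
    refine ⟨?_, _, hrep⟩
    rw [hrep.map_eq, ← hw1]
    exact sum_congr rfl fun t ht => by simp [ht, hℓ t ht]
  have hcell : ∀ a ∈ A, ∃ T, IsCell B h T ∧ ∃ ε > 0, ∀ δ : ℝ, 0 ≤ δ → δ ≤ ε →
      ∃ c', IsConicRep T c' (a + δ • ∑ t ∈ T₀, t) := fun a ha => by
    obtain ⟨-, c, hc⟩ := hArep a ha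
    exact exists_isCell_segment hB h0 hgen hc hz
  choose! T hT ε hε hseg using hcell
  classical
  -- An arbitrary order decides which pair of each swap is discarded.
  let _ : LinearOrder V := linearOrderOfSTO WellOrderingRel
  let S : Finset (V × V) := A.biUnion fun a => {a} ×ˢ T a
  have hmemS : ∀ p, p ∈ S ↔ p.1 ∈ A ∧ p.2 ∈ T p.1 := by
    rintro ⟨a, b⟩
    simp [S]
  have hcardS : #S = #A * finrank ℝ V := by
    rw [card_biUnion]
    · rw [sum_congr rfl (g := fun _ => finrank ℝ V) fun a ha => by
        rw [card_product, card_singleton, one_mul, (hT a ha).card_eq], sum_const, smul_eq_mul]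
    · intro a _ a' _ hne
      rw [Function.onFun, Finset.disjoint_left]
      simp only [mem_product, mem_singleton]
      rintro p ⟨h1, -⟩ ⟨h2, -⟩
      exact hne (h1.symm.trans h2)
  let D : Finset (V × V) := (T₀ ×ˢ T₀).filter fun p => p.1 < p.2
  have hcardD : #D ≤ (finrank ℝ V).choose 2 := by
    rw [← hT₀.card_eq]
    exact card_filter_lt_le_choose T₀
  have hrep0 : ∀ a ∈ A, ∃ c, IsConicRep (T a) c a := fun a ha => by
    simpa using hseg a ha 0 le_rfl (hε a ha).le
  have hinj : #(S \ D) ≤ #(A + B) := by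
    refine card_le_card_of_injOn (fun p => p.1 + p.2) (fun p hp => ?_) ?_
    · have hp := (hmemS p).1 (mem_sdiff.1 hp).1
      exact add_mem_add hp.1 ((hT _ hp.1).subset hp.2)
    · rintro ⟨a, b⟩ hp ⟨a', b'⟩ hq heq
      obtain ⟨hpS, hpD⟩ := mem_sdiff.1 (mem_coe.1 hp)
      obtain ⟨hqS, hqD⟩ := mem_sdiff.1 (mem_coe.1 hq)
      obtain ⟨ha, hb⟩ := (hmemS _).1 hpS
      obtain ⟨ha', hb'⟩ := (hmemS _).1 hqS
      dsimp only at heq ha hb ha' hb'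
      by_cases hbb : b = b'
      · subst hbb
        rw [add_right_cancel heq]
      exfalso
      obtain ⟨c, hc⟩ := hrep0 a ha
      obtain ⟨c', hc'⟩ := hrep0 a' ha'
      have h1 : a = b' := swap_of_add_eq hℓ (hT a ha) (hT a' ha') (hArep a ha).1 hc hc' hb hb'
        heq hbb
      have h2 : a' = b := swap_of_add_eq hℓ (hT a' ha') (hT a ha) (hArep a' ha').1 hc' hc hb' hb
        heq.symm (Ne.symm hbb)
      subst h1 h2
      have hδ : 0 < min (ε a) (ε a') := lt_min (hε a ha) (hε a' ha')
      obtain ⟨e, he⟩ := hseg a ha _ hδ.le (min_le_left _ _)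
      obtain ⟨e', he'⟩ := hseg a' ha' _ hδ.le (min_le_right _ _)
      have m1 := mem_of_isConicRep_toward hT₀ (hT a ha) (hT a' ha') hδ he he' hb hb' (Ne.symm hbb)
      have m2 := mem_of_isConicRep_toward hT₀ (hT a' ha') (hT a ha) hδ he' he hb' hb hbb
      rcases lt_or_gt_of_ne hbb with hlt | hlt
      · exact hqD (mem_filter.2 ⟨mem_product.2 ⟨m2, m1⟩, hlt⟩)
      · exact hpD (mem_filter.2 ⟨mem_product.2 ⟨m1, m2⟩, hlt⟩)
  have := le_card_sdiff D S
  omega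

end

/-! ### Homogenisation -/

/-- A nonempty proper set spans `ℝ^d × ℝ` once placed at height one. -/
theorem IsProperDimensional.span_eq_top {d : ℕ} {B : Set (EuclideanSpace ℝ (Fin d))}
    (hB : IsProperDimensional B) (hne : B.Nonempty) :
    Submodule.span ℝ ((fun x => (x, (1 : ℝ))) '' B) = ⊤ := by
  by_contra hs
  obtain ⟨g, hg0, hg⟩ := Submodule.exists_le_ker_of_lt_top _ (lt_top_iff_ne_top.2 hs)
  have hdecomp : ∀ x t, g (x, t) = g (x, 0) + t * g (0, 1) := fun x t => by
    rw [← smul_eq_mul, ← map_smul, ← map_add]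
    simp
  have hzero : ∀ b ∈ B, g (b, 0) = -g (0, 1) := fun b hb => by
    have h1 : g (b, 1) = 0 := hg (Submodule.subset_span ⟨b, hb, rfl⟩)
    rw [hdecomp] at h1
    linarith
  by_cases hf : g ∘ₗ LinearMap.inl ℝ _ ℝ = 0
  · have hx : ∀ x, g (x, 0) = 0 := fun x => LinearMap.congr_fun hf x
    obtain ⟨b, hb⟩ := hne
    have h1 := hzero b hb
    rw [hx] at h1
    refine hg0 (LinearMap.ext fun p => ?_)
    rw [show p = (p.1, p.2) from rfl, hdecomp, hx, neg_eq_zero.1 h1.symm]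
    simp
  · exact hB _ ⟨_, -g (0, 1), hf, rfl⟩ fun b hb => hzero b hb

theorem theorem3 (d m : ℕ) (A B : Set (EuclideanSpace ℝ (Fin d)))
    (hA : A.Finite) (hB : B.Finite) (hm : A.ncard = m)
    (hproper : IsProperDimensional B) (hsub : A ⊆ convexHull ℝ B) :
    ((A + B).ncard : ℝ) ≥ (m : ℝ) * ((d : ℝ) + 1) - (d : ℝ) * ((d : ℝ) + 1) / 2 := by
  classical
  -- For `d = 0` the empty set is vacuously proper, so nonemptiness of `B` has to come from `A`.
  rcases A.eq_empty_or_nonempty with rfl | hAne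
  · have : m = 0 := by simpa using hm.symm
    subst this
    have : (0 : ℝ) ≤ (d : ℝ) * ((d : ℝ) + 1) / 2 := by positivity
    simp only [Nat.cast_zero, zero_mul, zero_sub]
    exact (neg_nonpos.2 this).trans (Nat.cast_nonneg _)
  have hBne : B.Nonempty := convexHull_nonempty_iff.1 (hAne.mono hsub)
  lift A to Finset (EuclideanSpace ℝ (Fin d)) using hA
  lift B to Finset (EuclideanSpace ℝ (Fin d)) using hB
  let ι : EuclideanSpace ℝ (Fin d) → EuclideanSpace ℝ (Fin d) × ℝ := fun x => (x, 1)
  have hι : Function.Injective ι := fun x y h => congrArg Prod.fst h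
  have hbound := card_mul_finrank_le (A := A.image ι) (B := B.image ι)
    (ℓ := LinearMap.snd ℝ (EuclideanSpace ℝ (Fin d)) ℝ) (by simp [ι])
    (by rw [coe_image]; exact hproper.span_eq_top hBne) (by
      intro a ha
      obtain ⟨x, hx, rfl⟩ := mem_image.1 ha
      have hprod : convexHull ℝ ((B : Set (EuclideanSpace ℝ (Fin d))) ×ˢ {(1 : ℝ)}) =
          convexHull ℝ (B : Set _) ×ˢ {1} := by rw [convexHull_prod, convexHull_singleton]
      have himage : ((B.image ι : Finset _) : Set (EuclideanSpace ℝ (Fin d) × ℝ)) =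
          (B : Set _) ×ˢ {1} := by
        rw [coe_image, Set.prod_singleton]
      rw [himage, hprod]
      exact ⟨hsub hx, rfl⟩)
  have hsum : #(A.image ι + B.image ι) = #(A + B) := by
    have : A.image ι + B.image ι = (A + B).image fun x => (x, (2 : ℝ)) := by
      ext ⟨x, t⟩
      simp only [mem_add, mem_image, ι, Prod.mk.injEq]
      constructor
      · rintro ⟨_, ⟨a, ha, rfl⟩, _, ⟨b, hb, rfl⟩, h⟩
        simp only [Prod.mk_add_mk, Prod.mk.injEq] at h
        exact ⟨a + b, ⟨a, ha, b, hb, rfl⟩, h.1, by rw [← h.2]; norm_num⟩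
      · rintro ⟨_, ⟨a, ha, b, hb, rfl⟩, rfl, rfl⟩
        exact ⟨_, ⟨a, ha, rfl⟩, _, ⟨b, hb, rfl⟩, by simp; norm_num⟩
    rw [this, card_image_of_injective _ fun x y h => congrArg Prod.fst h]
  rw [hsum, card_image_of_injective _ hι, finrank_prod, finrank_euclideanSpace_fin,
    finrank_self] at hbound
  rw [← coe_add, Set.ncard_coe_finset, ← hm, Set.ncard_coe_finset]
  have hchoose : (((d + 1).choose 2 : ℕ) : ℝ) = (d : ℝ) * ((d : ℝ) + 1) / 2 := by
    rw [Nat.cast_choose_two]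
    push_cast
    ring
  have hreal : ((#A * (d + 1) : ℕ) : ℝ) ≤ ((#(A + B) + (d + 1).choose 2 : ℕ) : ℝ) := by
    exact_mod_cast hbound
  push_cast [hchoose] at hreal
  linarith
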